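/- Theorem. Fix numbers $m,p$ of inputs and outputs, and let $C^\infty_k$ denote the space of smooth functions $\mathbb{R}\to\mathbb{R}^k$. All polynomial matrices below are univariate with real coefficients. An \emph{input system} $\mathrm{E}$ is a system of equations $0=E(\tfrac{d}{dt})u$ with $E(s)$ a polynomial matrix with $m$ columns; its input behaviour is $\mathfrak{B}_{\mathrm i}(\mathrm{E})=\{u\in C^\infty_m : 0=E(\tfrac{d}{dt})u\}$. For a system $S$ of the form $G(\tfrac{d}{dt})y=H(\tfrac{d}{dt})u$, with $G(s)$, $H(s)$ polynomial matrices with $p$ and $m$ columns respectively and equally many rows, the external behaviour is $\mathfrak{B}(S)=\{(u,y)\in C^\infty_m\times C^\infty_p : G(\tfrac{d}{dt})y=H(\tfrac{d}{dt})u\}$, and the interconnection $\mathrm{E}\wedge S$ is the system $$\begin{bmatrix}G(\tfrac{d}{dt})\\0\end{bmatrix}y=\begin{bmatrix}H(\tfrac{d}{dt})\\E(\tfrac{d}{dt})\end{bmatrix}u.$$ A system $P(\tfrac{d}{dt})y=Q(\tfrac{d}{dt})u$ is in \emph{input-output form} if $P(s)$ is square and invertible as a rational matrix and every entry of $P(s)^{-1}Q(s)$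 is a proper rational function. A \emph{contract} $\mathcal{C}=(\mathrm{A},\Gamma)$ consists of assumptions $\mathrm{A}$, which are an input system, and guarantees $\Gamma$, which are a system $G(\tfrac{d}{dt})y=H(\tfrac{d}{dt})u$. An environment, i.e. an input system $\mathrm{E}$, is \emph{compatible} with $\mathcal{C}$ if $\mathfrak{B}_{\mathrm i}(\mathrm{E})\subset\mathfrak{B}_{\mathrm i}(\mathrm{A})$. A system $\Sigma$ in input-output form is an \emph{implementation} of $\mathcal{C}$ if $\mathfrak{B}(\mathrm{E}\wedge\Sigma)\subset\mathfrak{B}(\Gamma)$ for every environment $\mathrm{E}$ compatible with $\mathcal{C}$. The contract $\mathcal{C}$ is \emph{consistent} if it has at least one implementation. A contract $\mathcal{C}_1$ \emph{refines} $\mathcal{C}_2$ if every environment compatible with $\mathcal{C}_2$ is compatible with $\mathcal{C}_1$ and every implementation of $\mathcal{C}_1$ is an implementation of $\mathcal{C}_2$. (Here $\subset$ allows equality.) Let $\mathcal{C}_1=(\mathrm{A}_1,\Gamma_1)$ and $\mathcal{C}_2=(\mathrm{A}_2,\Gamma_2)$ be contracts with the same $m$ and $p$, and suppose that $\mathcal{C}_1$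 is consistent. Then $\mathcal{C}_1$ refines $\mathcal{C}_2$ if and only if $$\mathfrak{B}_{\mathrm i}(\mathrm{A}_2)\subset\mathfrak{B}_{\mathrm i}(\mathrm{A}_1)\quad\text{and}\quad\mathfrak{B}(\mathrm{A}_2\wedge\Gamma_1)\subset\mathfrak{B}(\Gamma_2).$$ In this case, $\mathcal{C}_2$ is also consistent. -/

import Mathlib

open scoped ContDiff Polynomial

noncomputable section

namespace LinearContract

/-- The real vector space of smooth functions from `ℝ` to `E`. -/
def Smooth (E : Type) [NormedAddCommGroup E] [NormedSpace ℝ E] : Submodule ℝ (ℝ → E) where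
  carrier := {f | ContDiff ℝ ∞ f}
  add_mem' hf hg := Set.mem_ofPred_eq.mpr
    (ContDiff.add (Set.mem_ofPred_eq.mp hf) (Set.mem_ofPred_eq.mp hg))
  zero_mem' := Set.mem_ofPred_eq.mpr contDiff_const
  smul_mem' c _ hf := Set.mem_ofPred_eq.mpr (ContDiff.const_smul c (Set.mem_ofPred_eq.mp hf))

theorem mem_smooth {E : Type} [NormedAddCommGroup E] [NormedSpace ℝ E] {f : ℝ → E} :
    f ∈ Smooth E ↔ ContDiff ℝ ∞ f := Iff.rfl

/-- The space of smooth trajectories in `ℝⁿ`. -/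
abbrev CInf (n : ℕ) : Type := Smooth (Fin n → ℝ)

/-- The `j`-th component of a smooth trajectory in `ℝⁿ`. -/
def CInf.comp {n : ℕ} (w : CInf n) (j : Fin n) : Smooth ℝ :=
  ⟨fun t => w.1 t j, mem_smooth.2 (contDiff_pi.1 (mem_smooth.1 w.2) j)⟩

theorem contDiff_deriv {f : ℝ → ℝ} (hf : f ∈ Smooth ℝ) :
    Differentiable ℝ f ∧ deriv f ∈ Smooth ℝ :=
  contDiff_infty_iff_deriv.1 (mem_smooth.1 hf)

/-- The differentiation operator `d/dt` on smooth scalar functions. -/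
def ddt : Module.End ℝ (Smooth ℝ) where
  toFun f := ⟨deriv f.1, (contDiff_deriv f.2).2⟩
  map_add' f g := by
    apply Subtype.ext
    funext t
    exact deriv_add ((contDiff_deriv f.2).1 t) ((contDiff_deriv g.2).1 t)
  map_smul' c f := by
    apply Subtype.ext
    funext t
    exact deriv_const_smul c ((contDiff_deriv f.2).1 t)

/-- `R(d/dt) w` for a polynomial matrix `R(s)`: the `i`-th entry is `∑ j, R i j (d/dt) (w j)`. -/
def applyDiff {r n : ℕ} (R : Matrix (Fin r) (Fin n) ℝ[X]) (w : CInf n) : Fin r → Smooth ℝ :=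
  fun i => ∑ j, Polynomial.aeval ddt (R i j) (w.comp j)

/-- A system `0 = E(d/dt) u` on the input alone, with `E(s)` a polynomial matrix having any
finite number of rows. Environments and assumptions are systems of this form. -/
structure InputSystem (m : ℕ) where
  rows : ℕ
  E : Matrix (Fin rows) (Fin m) ℝ[X]

/-- The input behaviour of a system `0 = E(d/dt) u`. -/
def InputSystem.inputBehaviour {m : ℕ} (e : InputSystem m) : Set (CInf m) :=
  {u | 0 = applyDiff e.E u}

/-- A system `G(d/dt) y = H(d/dt) u`, with `G(s)` and `H(s)` polynomial matrices having the same
(arbitrary) finite number of rows. Guarantees are systems of this form. -/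
structure ExtSystem (m p : ℕ) where
  rows : ℕ
  G : Matrix (Fin rows) (Fin p) ℝ[X]
  H : Matrix (Fin rows) (Fin m) ℝ[X]

/-- The external behaviour: the set of pairs `(u, y)` with `G(d/dt) y = H(d/dt) u`. -/
def ExtSystem.behaviour {m p : ℕ} (S : ExtSystem m p) : Set (CInf m × CInf p) :=
  {w | applyDiff S.G w.2 = applyDiff S.H w.1}

/-- The interconnection `E ∧ S`, given by the stacked equations `[G; 0](d/dt) y = [H; E](d/dt) u`. -/
def interconnect {m p : ℕ} (e : InputSystem m) (S : ExtSystem m p) : ExtSystem m p where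
  rows := S.rows + e.rows
  G := (Matrix.fromRows S.G 0).submatrix finSumFinEquiv.symm id
  H := (Matrix.fromRows S.H e.E).submatrix finSumFinEquiv.symm id

/-- A real polynomial matrix regarded as a rational matrix. -/
def toRat {r n : ℕ} (R : Matrix (Fin r) (Fin n) ℝ[X]) : Matrix (Fin r) (Fin n) (RatFunc ℝ) :=
  R.map (algebraMap ℝ[X] (RatFunc ℝ))

/-- A rational matrix is proper if, in each entry, the degree of the denominator is at least the
degree of the numerator. -/
def IsProper {r n : ℕ} (R : Matrix (Fin r) (Fin n) (RatFunc ℝ)) : Prop :=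
  ∀ i j, (R i j).num.degree ≤ (R i j).denom.degree

/-- A system `P(d/dt) y = Q(d/dt) u` in input-output form: `P(s)` is square and has a rational
inverse, and `P(s)⁻¹ Q(s)` is proper. -/
structure IOSystem (m p : ℕ) where
  P : Matrix (Fin p) (Fin p) ℝ[X]
  Q : Matrix (Fin p) (Fin m) ℝ[X]
  invertible : ∃ N : Matrix (Fin p) (Fin p) (RatFunc ℝ), toRat P * N = 1
  proper : IsProper ((toRat P)⁻¹ * toRat Q)

/-- The underlying system `P(d/dt) y = Q(d/dt) u`. -/
def IOSystem.toExt {m p : ℕ} (S : IOSystem m p) : ExtSystem m p where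
  rows := p
  G := S.P
  H := S.Q

/-- A contract is a pair of assumptions and guarantees. -/
structure Contract (m p : ℕ) where
  A : InputSystem m
  Γ : ExtSystem m p

/-- The environment `e` is compatible with the contract `C`. -/
def Compatible {m p : ℕ} (e : InputSystem m) (C : Contract m p) : Prop :=
  e.inputBehaviour ⊆ C.A.inputBehaviour

/-- The system `S` is an implementation of the contract `C`. -/
def Implements {m p : ℕ} (S : IOSystem m p) (C : Contract m p) : Prop :=
  ∀ e : InputSystem m, Compatible e C → (interconnect e S.toExt).behaviour ⊆ C.Γ.behaviour

/-- A contract is consistent if it has at least one implementation. -/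
def Consistent {m p : ℕ} (C : Contract m p) : Prop :=
  ∃ S : IOSystem m p, Implements S C

/-- `C₁` refines `C₂`. -/
def Refines {m p : ℕ} (C₁ C₂ : Contract m p) : Prop :=
  (∀ e : InputSystem m, Compatible e C₂ → Compatible e C₁) ∧
    (∀ S : IOSystem m p, Implements S C₁ → Implements S C₂)

end LinearContract

end

/-!
Write `Cᵢ = (Aᵢ, Γᵢ)`, with `Γᵢ` given by `Gᵢ(d/dt) y = Hᵢ(d/dt) u`, and let `P(d/dt) y = Q(d/dt) u`
be an implementation of `C₁`. The substance is that refinement forces the second inclusion. If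
`(u, y)` satisfies `A₂` and `Γ₁`, choose an output `y₀` of the implementation for the input `u`. As
the implementation also implements `C₂`, the pair `(u, y₀)` satisfies both guarantees, so it remains
to see that `G₁(d/dt) z = 0` implies `G₂(d/dt) z = 0`.

The algebra behind this is that smooth functions form a divisible `ℝ[X]`-module
(`aeval_ddt_surjective`) in which each nonunit kills a nonzero function
(`exists_aeval_ddt_eq_zero`). With the Smith normal form it follows that a row outside a
submodule `N` of `ℝ[X]ᵖ` is detected by a trajectory annihilated by `N`, which may even be taken
autonomous, i.e. annihilated by some `q(d/dt)` with `q ≠ 0` (`exists_trajectory_of_notMem`).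

Hence the rows of `G₁` lie in the row module of `P` (`Implements.row_mem_span`). Given an autonomous
`z` with `G₁(d/dt) z = 0`, the row vectors `w` with `(w P)(d/dt) z = 0` form a submodule containing
`q ℝ[X]ᵖ`, so they are generated by the rows of a nonsingular square matrix `W`. The system
`W P y = W Q u` has the same proper transfer matrix as the original one, the rows of `G₁` lie in the
row module of `W P`, and so it still implements `C₁`, now with `(0, z)` in its behaviour
(`Implements.exists_of_autonomous`). Refinement then yields `G₂(d/dt) z = 0`. Since autonomous
trajectories detect membership in the row module of `G₁`, the rows of `G₂` lie in that module
(`Implements.applyDiff_eq_zero_of_forall`), which gives the claim for every `z`.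
-/

noncomputable section

namespace LinearContract

/-! ### Surjectivity and kernels of scalar differential operators -/

/-- The complex vector space of smooth functions `ℝ → ℂ`. -/
def SmoothC : Submodule ℂ (ℝ → ℂ) where
  carrier := {f | ContDiff ℝ ∞ f}
  add_mem' hf hg := Set.mem_ofPred_eq.mpr
    (ContDiff.add (Set.mem_ofPred_eq.mp hf) (Set.mem_ofPred_eq.mp hg))
  zero_mem' := Set.mem_ofPred_eq.mpr contDiff_const
  smul_mem' c _ hf := Set.mem_ofPred_eq.mpr (ContDiff.const_smul c (Set.mem_ofPred_eq.mp hf))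

theorem mem_smoothC {f : ℝ → ℂ} : f ∈ SmoothC ↔ ContDiff ℝ ∞ f := Iff.rfl

theorem contDiff_derivC {f : ℝ → ℂ} (hf : f ∈ SmoothC) :
    Differentiable ℝ f ∧ deriv f ∈ SmoothC :=
  contDiff_infty_iff_deriv.1 (mem_smoothC.1 hf)

/-- The operator `d/dt` on smooth complex-valued functions. -/
def ddtC : Module.End ℂ SmoothC where
  toFun f := ⟨deriv f.1, (contDiff_derivC f.2).2⟩
  map_add' f g := by
    apply Subtype.ext
    funext t
    exact deriv_add ((contDiff_derivC f.2).1 t) ((contDiff_derivC g.2).1 t)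
  map_smul' c f := by
    apply Subtype.ext
    funext t
    exact deriv_const_smul c ((contDiff_derivC f.2).1 t)

theorem ddtC_eq_of_hasDerivAt {f g : SmoothC} (h : ∀ t, HasDerivAt f.1 (g.1 t) t) :
    ddtC f = g :=
  Subtype.ext (funext fun t => (h t).deriv)

theorem hasDerivAt_cexp (l : ℂ) (t : ℝ) :
    HasDerivAt (fun t : ℝ => Complex.exp (l * t)) (l * Complex.exp (l * t)) t := by
  have h : HasDerivAt (fun t : ℝ => l * (t : ℂ)) l t := by
    simpa using (Complex.ofRealCLM.hasDerivAt (x := t)).const_mul l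
  simpa [mul_comm] using h.cexp

/-- The exponential `t ↦ exp (l t)`. -/
def expC (l : ℂ) : SmoothC :=
  ⟨fun t => Complex.exp (l * t), mem_smoothC.2
    ((contDiff_const.mul Complex.ofRealCLM.contDiff).cexp)⟩

theorem ddtC_expC (l : ℂ) : ddtC (expC l) = l • expC l :=
  ddtC_eq_of_hasDerivAt fun t => hasDerivAt_cexp l t

theorem aeval_ddtC_expC (q : ℂ[X]) (l : ℂ) :
    Polynomial.aeval ddtC q (expC l) = q.eval l • expC l :=
  Module.End.aeval_apply_of_hasEigenvector ⟨Module.End.mem_eigenspace_iff.2 (ddtC_expC l),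
    fun h => by simpa [expC] using congrFun (congrArg Subtype.val h) 0⟩

/-- Variation of constants: `y' = l y + f` is solvable. -/
theorem ddtC_sub_surjective (l : ℂ) :
    Function.Surjective (ddtC - algebraMap ℂ (Module.End ℂ SmoothC) l) := by
  intro f
  have hf : ContDiff ℝ ∞ f.1 := mem_smoothC.1 f.2
  set g : ℝ → ℂ := fun t => Complex.exp (-l * t) * f.1 t with hg_def
  have hg : ContDiff ℝ ∞ g := (mem_smoothC.1 (expC (-l)).2).mul hf
  have hG (t : ℝ) : HasDerivAt (fun t => ∫ s in (0 : ℝ)..t, g s) (g t) t :=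
    intervalIntegral.integral_hasDerivAt_right (hg.continuous.intervalIntegrable _ _)
      (hg.continuous.stronglyMeasurableAtFilter _ _) hg.continuous.continuousAt
  have hGs : ContDiff ℝ ∞ (fun t => ∫ s in (0 : ℝ)..t, g s) := by
    refine contDiff_infty_iff_deriv.2 ⟨fun t => (hG t).differentiableAt, ?_⟩
    rwa [show deriv (fun t => ∫ s in (0 : ℝ)..t, g s) = g from funext fun t => (hG t).deriv]
  let y : SmoothC := ⟨_, mem_smoothC.2 ((mem_smoothC.1 (expC l).2).mul hGs)⟩
  refine ⟨y, ?_⟩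
  have : ddtC y = l • y + f := by
    refine ddtC_eq_of_hasDerivAt fun t => ?_
    refine ((hasDerivAt_cexp l t).mul (hG t)).congr_deriv ?_
    have he : Complex.exp (l * t) * Complex.exp (-l * t) = 1 := by
      rw [← Complex.exp_add]; simp
    change _ = l * (Complex.exp (l * t) * ∫ s in (0 : ℝ)..t, g s) + f.1 t
    rw [show Complex.exp (l * t) * g t = f.1 t by rw [hg_def, ← mul_assoc, he, one_mul], mul_assoc]
  simp [this, Module.algebraMap_end_apply]

theorem aeval_surjective_of_sub_surjective {V : Type*} [AddCommGroup V] [Module ℂ V]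
    (T : Module.End ℂ V)
    (hT : ∀ l, Function.Surjective (T - algebraMap ℂ (Module.End ℂ V) l)) {q : ℂ[X]} (hq : q ≠ 0) :
    Function.Surjective (Polynomial.aeval T q) := by
  have hroots (s : Multiset ℂ) : Function.Surjective
      (Polynomial.aeval T (s.map fun l => Polynomial.X - Polynomial.C l).prod) := by
    induction s using Multiset.induction_on with
    | empty =>
      rw [Multiset.map_zero, Multiset.prod_zero, map_one]
      exact Function.surjective_id
    | cons l s ih =>
      rw [Multiset.map_cons, Multiset.prod_cons, map_mul, Module.End.mul_eq_comp, LinearMap.coe_comp]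
      simpa using (hT l).comp ih
  intro v
  obtain ⟨w, hw⟩ := hroots q.roots (q.leadingCoeff⁻¹ • v)
  refine ⟨w, ?_⟩
  rw [(IsAlgClosed.splits q).eq_prod_roots, map_mul, Module.End.mul_apply, hw]
  simp [Module.algebraMap_end_apply, hq]

/-- The real part of a smooth complex function. -/
def reSmooth : SmoothC →ₗ[ℝ] Smooth ℝ where
  toFun f := ⟨fun t => (f.1 t).re, mem_smooth.2 (Complex.reCLM.contDiff.comp (mem_smoothC.1 f.2))⟩
  map_add' _ _ := rfl
  map_smul' c f := by
    apply Subtype.ext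
    funext t
    simp

theorem reSmooth_ddtC (f : SmoothC) : reSmooth (ddtC f) = ddt (reSmooth f) := by
  apply Subtype.ext
  funext t
  exact ((Complex.reCLM.hasFDerivAt.comp_hasDerivAt t
    ((contDiff_derivC f.2).1 t).hasDerivAt).deriv).symm

theorem reSmooth_aeval (q : ℝ[X]) (f : SmoothC) :
    reSmooth (Polynomial.aeval ddtC (q.map (algebraMap ℝ ℂ)) f) =
      Polynomial.aeval ddt q (reSmooth f) := by
  induction q using Polynomial.induction_on generalizing f with
  | C a =>
    apply Subtype.ext
    funext t
    simp [reSmooth, Module.algebraMap_end_apply]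
  | add p q hp hq =>
    rw [Polynomial.map_add, map_add, map_add, LinearMap.add_apply, LinearMap.add_apply, map_add,
      hp, hq]
  | monomial n a ih =>
    rw [pow_succ, ← mul_assoc, Polynomial.map_mul, map_mul, map_mul, Polynomial.map_X,
      Polynomial.aeval_X, Polynomial.aeval_X, Module.End.mul_apply, Module.End.mul_apply, ih,
      reSmooth_ddtC]

theorem aeval_ddt_surjective {q : ℝ[X]} (hq : q ≠ 0) :
    Function.Surjective (Polynomial.aeval ddt q) := by
  intro f
  let fC : SmoothC :=
    ⟨fun t => (f.1 t : ℂ), mem_smoothC.2 (Complex.ofRealCLM.contDiff.comp (mem_smooth.1 f.2))⟩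
  obtain ⟨y, hy⟩ := aeval_surjective_of_sub_surjective ddtC ddtC_sub_surjective
    ((Polynomial.map_ne_zero_iff (algebraMap ℝ ℂ).injective).2 hq) fC
  refine ⟨reSmooth y, ?_⟩
  rw [← reSmooth_aeval, hy]
  rfl

/-- The real part of an exponential at a complex root of `q` solves `q(d/dt) f = 0`. -/
theorem exists_aeval_ddt_eq_zero {q : ℝ[X]} (hu : ¬ IsUnit q) :
    ∃ f : Smooth ℝ, f ≠ 0 ∧ Polynomial.aeval ddt q f = 0 := by
  obtain ⟨l, hl⟩ := IsAlgClosed.exists_aeval_eq_zero ℂ q (by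
    rw [Ne, ← Polynomial.isUnit_iff_degree_eq_zero]; exact hu)
  refine ⟨reSmooth (expC l), fun h => ?_, ?_⟩
  · simpa [expC, reSmooth] using congrFun (congrArg Subtype.val h) 0
  · rw [← reSmooth_aeval, aeval_ddtC_expC, Polynomial.eval_map_algebraMap, hl, zero_smul, map_zero]

/-! ### Submodules of free modules over a principal ideal domain -/

section PrincipalIdealDomain

variable {R F ι : Type*} [CommRing R] [IsDomain R] [IsPrincipalIdealRing R]
  [AddCommGroup F] [Module R F] [Finite ι]

/-- In a divisible module in which every nonunit kills a nonzero element, a scalar `c` that is not a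
multiple of `a` acts nontrivially on some torsion element of the kernel of `a`. For `a ≠ 0` write
`a = g e` with `g = gcd(a, c)` and take `f` with `g • f = h`, where `h ≠ 0` is killed by `e`. -/
theorem exists_smul_eq_zero_and_smul_ne_zero
    (hdiv : ∀ q : R, q ≠ 0 → Function.Surjective fun f : F => q • f)
    (hker : ∀ q : R, ¬ IsUnit q → ∃ f : F, f ≠ 0 ∧ q • f = 0)
    (htr : ∃ x : R, x ≠ 0 ∧ ¬ IsUnit x) {a c : R} (hac : ¬ a ∣ c) :
    ∃ f : F, ∃ q : R, q ≠ 0 ∧ q • f = 0 ∧ a • f = 0 ∧ c • f ≠ 0 := by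
  wlog ha : a ≠ 0 generalizing a
  · -- For `a = 0`, pass to the nonzero scalar `c x` with `x` a nonunit, which does not divide `c`.
    rw [not_not] at ha
    subst ha
    obtain ⟨x, hx, hxu⟩ := htr
    have hc : c ≠ 0 := fun h => hac (by simp [h])
    have hxc : ¬ c * x ∣ c := fun h => hxu (by
      obtain ⟨y, hy⟩ := h
      exact .of_mul_eq_one y (mul_left_cancel₀ hc (by rw [← mul_assoc, ← hy, mul_one])))
    obtain ⟨f, q, h1, h2, -, h4⟩ := this hxc (mul_ne_zero hc hx)
    exact ⟨f, q, h1, h2, zero_smul _ _, h4⟩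
  obtain ⟨g, hg⟩ := (IsPrincipalIdealRing.principal (Ideal.span {a, c})).principal
  rw [← Ideal.submodule_span_eq] at hg
  have hmem (x : R) : g ∣ x ↔ x ∈ Submodule.span R {a, c} := by
    rw [hg]; exact Ideal.mem_span_singleton.symm
  obtain ⟨e, rfl⟩ := (hmem a).2 (Submodule.subset_span (by simp))
  obtain ⟨d, hd⟩ := (hmem c).2 (Submodule.subset_span (by simp))
  have he : ¬ IsUnit e := fun he => hac (by
    rw [IsUnit.mul_right_dvd he, hd]; exact dvd_mul_right _ _)
  obtain ⟨x, y, hxy⟩ := Submodule.mem_span_pair.1 ((hmem g).1 dvd_rfl)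
  obtain ⟨h, h0, heh⟩ := hker e he
  obtain ⟨f, hf⟩ := hdiv g (left_ne_zero_of_mul ha) h
  have haf : (g * e) • f = 0 := by rw [mul_comm, mul_smul, show g • f = h from hf, heh]
  refine ⟨f, g * e, ha, haf, haf, fun hcf => h0 ?_⟩
  rw [← show g • f = h from hf, ← hxy, smul_eq_mul, smul_eq_mul, add_smul, mul_smul x, mul_smul y,
    haf, hcf]
  simp

/-- Linear maps into `F` with torsion image separate a submodule of a free module from the elements
outside it. In Smith normal form the claim concerns a single coordinate. -/
theorem exists_linearMap_of_notMem {M : Type*} [AddCommGroup M] [Module R M]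
    (hF : ∀ a c : R, ¬ a ∣ c → ∃ f : F, ∃ q : R, q ≠ 0 ∧ q • f = 0 ∧ a • f = 0 ∧ c • f ≠ 0)
    (b : Module.Basis ι R M) {N : Submodule R M} {n : M} (hn : n ∉ N) :
    ∃ φ : M →ₗ[R] F, (∀ x ∈ N, φ x = 0) ∧ φ n ≠ 0 ∧ ∃ q : R, q ≠ 0 ∧ ∀ x, q • φ x = 0 := by
  have := Fintype.ofFinite ι
  obtain ⟨k, snf⟩ := Submodule.smithNormalForm b N
  -- `n` has a coordinate that violates a divisibility satisfied by that coordinate on all of `N`.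
  have key : ∃ i, ∃ a : R, ¬ a ∣ snf.bM.repr n i ∧ ∀ x ∈ N, a ∣ snf.bM.repr x i := by
    by_contra! hall
    refine hn ?_
    rw [← snf.bM.sum_repr n]
    refine N.sum_mem fun i _ => ?_
    by_cases hi : i ∈ Set.range snf.f
    · obtain ⟨j, rfl⟩ := hi
      have hdvd : snf.a j ∣ snf.bM.repr n (snf.f j) := by
        by_contra hnd
        obtain ⟨x, hx, hx'⟩ := hall _ _ hnd
        refine hx' ?_
        rw [snf.repr_apply_embedding_eq_repr_smul (m := ⟨x, hx⟩), map_smul, Finsupp.smul_apply,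
          smul_eq_mul]
        exact dvd_mul_right _ _
      obtain ⟨c, hc⟩ := hdvd
      rw [hc, mul_comm, mul_smul, ← snf.snf]
      exact N.smul_mem _ (snf.bN j).2
    · have h0 : snf.bM.repr n i = 0 := by
        by_contra hnd
        obtain ⟨x, hx, hx'⟩ := hall i 0 (by rwa [zero_dvd_iff])
        exact hx' (by rw [snf.repr_eq_zero_of_notMem_range ⟨x, hx⟩ hi])
      simp [h0]
  obtain ⟨i, a, hna, hN⟩ := key
  obtain ⟨f, q, hq, hqf, haf, hcf⟩ := hF _ _ hna
  refine ⟨(LinearMap.toSpanSingleton R F f).comp (snf.bM.coord i), fun x hx => ?_, ?_, q, hq,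
    fun x => ?_⟩
  · obtain ⟨d, hd⟩ := hN x hx
    simp [hd, mul_comm a, mul_smul, haf]
  · simpa using hcf
  · simp [smul_comm q, hqf]

/-- A submodule of `Rᵖ` that contains `q Rᵖ` for some `q ≠ 0` is generated by the rows of a square
matrix with nonzero determinant. -/
theorem exists_matrix_of_smul_mem {p : ℕ} {N : Submodule R (Fin p → R)} {q : R} (hq : q ≠ 0)
    (hN : ∀ x, q • x ∈ N) :
    ∃ W : Matrix (Fin p) (Fin p) R, W.det ≠ 0 ∧ (∀ i, W i ∈ N) ∧
      ∀ x ∈ N, ∃ c : Fin p → R, x = Matrix.vecMul c W := by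
  have hrank : Module.finrank R N = p := by
    apply le_antisymm
    · simpa using Submodule.finrank_le N
    · let g : (Fin p → R) →ₗ[R] N := (LinearMap.lsmul R (Fin p → R) q).codRestrict N hN
      have hg : Function.Injective g := fun x y h => by
        have : q • x = q • y := congrArg Subtype.val h
        exact smul_right_injective _ hq this
      simpa using LinearMap.finrank_le_finrank_of_injective hg
  let b := Module.finBasisOfFinrankEq R N hrank
  let W : Matrix (Fin p) (Fin p) R := fun i => (b i : Fin p → R)
  have hW : ∀ x ∈ N, ∃ c : Fin p → R, x = Matrix.vecMul c W := fun x hx => by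
    refine ⟨b.repr ⟨x, hx⟩, ?_⟩
    rw [Matrix.vecMul_eq_sum]
    conv_lhs => rw [show x = ((⟨x, hx⟩ : N) : Fin p → R) from rfl, ← b.sum_repr ⟨x, hx⟩]
    simp only [Submodule.coe_sum, Submodule.coe_smul, W]
  refine ⟨W, ?_, fun i => (b i).2, hW⟩
  -- Expressing `q` times the unit vectors through the rows of `W` gives `T W = q I`.
  choose T hT using fun i => hW _ (hN (Pi.single i 1))
  have hTW : Matrix.of T * W = Matrix.scalar (Fin p) q := by
    ext i j
    rw [Matrix.mul_apply_eq_vecMul]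
    rw [show Matrix.vecMul (Matrix.of T i) W = q • Pi.single i 1 from (hT i).symm]
    simp [Matrix.diagonal_apply, Pi.single_apply, eq_comm]
  have hdet := congrArg Matrix.det hTW
  rw [Matrix.det_mul, Matrix.scalar_apply, Matrix.det_diagonal] at hdet
  intro h0
  rw [h0, mul_zero] at hdet
  exact pow_ne_zero p hq (by simpa using hdet.symm)

end PrincipalIdealDomain
/-! ### Polynomial matrices acting on smooth trajectories -/

/-- Smooth scalar functions as a module over `ℝ[X]`, with `X` acting as `d/dt`. -/
instance smoothModule : Module ℝ[X] (Smooth ℝ) :=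
  Module.compHom (Smooth ℝ) (Polynomial.aeval ddt).toRingHom

theorem polynomial_smul_def (q : ℝ[X]) (f : Smooth ℝ) : q • f = Polynomial.aeval ddt q f := rfl

/-- The map sending a row vector `r(s)` of polynomials to `r(d/dt) w`. -/
def rowAct {n : ℕ} (w : CInf n) : (Fin n → ℝ[X]) →ₗ[ℝ[X]] Smooth ℝ :=
  Fintype.linearCombination ℝ[X] w.comp

theorem rowAct_apply {n : ℕ} (w : CInf n) (r : Fin n → ℝ[X]) :
    rowAct w r = ∑ j, r j • w.comp j :=
  Fintype.linearCombination_apply ..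

theorem applyDiff_apply {r n : ℕ} (R : Matrix (Fin r) (Fin n) ℝ[X]) (w : CInf n) (i : Fin r) :
    applyDiff R w i = rowAct w (R i) := (rowAct_apply w (R i)).symm

theorem rowAct_sub {n : ℕ} (w w' : CInf n) (r : Fin n → ℝ[X]) :
    rowAct (w - w') r = rowAct w r - rowAct w' r := by
  simp only [rowAct_apply, ← Finset.sum_sub_distrib, ← smul_sub]
  rfl

theorem applyDiff_sub {r n : ℕ} (R : Matrix (Fin r) (Fin n) ℝ[X]) (w w' : CInf n) :
    applyDiff R (w - w') = applyDiff R w - applyDiff R w' := by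
  funext i
  simp only [Pi.sub_apply, applyDiff_apply, rowAct_sub]

theorem applyDiff_zero {r n : ℕ} (R : Matrix (Fin r) (Fin n) ℝ[X]) :
    applyDiff R (0 : CInf n) = 0 := by
  simpa using applyDiff_sub R 0 0

theorem rowAct_vecMul {r n : ℕ} (c : Fin r → ℝ[X]) (R : Matrix (Fin r) (Fin n) ℝ[X])
    (w : CInf n) : rowAct w (Matrix.vecMul c R) = ∑ i, c i • applyDiff R w i := by
  simp only [Matrix.vecMul_eq_sum, map_sum, map_smul, applyDiff_apply]

/-- The trajectory in `ℝⁿ` with given components. -/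
def ofComp {n : ℕ} (x : Fin n → Smooth ℝ) : CInf n :=
  ⟨fun t j => (x j).1 t, mem_smooth.2 (contDiff_pi.2 fun j => mem_smooth.1 (x j).2)⟩

theorem applyDiff_ofComp {r n : ℕ} (R : Matrix (Fin r) (Fin n) ℝ[X]) (x : Fin n → Smooth ℝ)
    (i : Fin r) : applyDiff R (ofComp x) i = ∑ j, R i j • x j := rfl

theorem applyDiff_mul {r n k : ℕ} (A : Matrix (Fin r) (Fin k) ℝ[X])
    (B : Matrix (Fin k) (Fin n) ℝ[X]) (w : CInf n) :
    applyDiff (A * B) w = applyDiff A (ofComp (applyDiff B w)) := by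
  funext i
  rw [applyDiff_apply, Matrix.mul_apply_eq_vecMul, rowAct_vecMul, applyDiff_ofComp]

/-- Every `ℝ[X]`-linear map into the smooth functions is evaluation on a trajectory. -/
theorem exists_rowAct_eq {n : ℕ} (φ : (Fin n → ℝ[X]) →ₗ[ℝ[X]] Smooth ℝ) :
    ∃ w : CInf n, rowAct w = φ := by
  refine ⟨ofComp fun j => φ (Pi.single j 1), (Pi.basisFun ℝ[X] (Fin n)).ext fun j => ?_⟩
  rw [Pi.basisFun_apply]
  exact (Fintype.linearCombination_apply_single ..).trans (one_smul _ _)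

/-- A square system with nonzero determinant is solvable for every right-hand side. -/
theorem exists_applyDiff_eq {p : ℕ} {P : Matrix (Fin p) (Fin p) ℝ[X]} (hP : P.det ≠ 0)
    (b : Fin p → Smooth ℝ) : ∃ y : CInf p, applyDiff P y = b := by
  choose v hv using fun i => aeval_ddt_surjective hP (b i)
  refine ⟨ofComp (applyDiff P.adjugate (ofComp v)), ?_⟩
  rw [← applyDiff_mul, Matrix.mul_adjugate]
  funext i
  rw [applyDiff_ofComp, Finset.sum_eq_single i (by simp +contextual [Ne.symm]) (by simp)]
  simpa [polynomial_smul_def] using hv i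

/-- A row not in the polynomial row module `N` is detected by a trajectory that `N` annihilates,
and this trajectory can be chosen to be annihilated by a nonzero scalar operator. -/
theorem exists_trajectory_of_notMem {n : ℕ} {N : Submodule ℝ[X] (Fin n → ℝ[X])}
    {r : Fin n → ℝ[X]} (hr : r ∉ N) :
    ∃ w : CInf n, (∀ x ∈ N, rowAct w x = 0) ∧ rowAct w r ≠ 0 ∧
      ∃ q : ℝ[X], q ≠ 0 ∧ ∀ x, q • rowAct w x = 0 := by
  obtain ⟨φ, hφ⟩ := exists_linearMap_of_notMem (F := Smooth ℝ)
    (fun a c => exists_smul_eq_zero_and_smul_ne_zero (fun q hq => aeval_ddt_surjective hq)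
      (fun q hq => exists_aeval_ddt_eq_zero hq) ⟨Polynomial.X, Polynomial.X_ne_zero,
        Polynomial.not_isUnit_X⟩)
    (Pi.basisFun ℝ[X] (Fin n)) hr
  obtain ⟨w, rfl⟩ := exists_rowAct_eq φ
  exact ⟨w, hφ⟩

/-- The kernel of `R(d/dt)` depends only on the module generated by the rows of `R(s)`. -/
theorem applyDiff_eq_zero_iff {r n : ℕ} (R : Matrix (Fin r) (Fin n) ℝ[X]) (w : CInf n) :
    applyDiff R w = 0 ↔ ∀ x ∈ Submodule.span ℝ[X] (Set.range R.row), rowAct w x = 0 := by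
  have : (∀ x ∈ Submodule.span ℝ[X] (Set.range R.row), rowAct w x = 0) ↔
      Submodule.span ℝ[X] (Set.range R.row) ≤ LinearMap.ker (rowAct w) := Iff.rfl
  rw [this, Submodule.span_le, Set.range_subset_iff, funext_iff]
  simp only [applyDiff_apply]
  rfl

/-! ### Systems in input-output form -/

theorem mem_interconnect {m p : ℕ} {e : InputSystem m} {S : ExtSystem m p}
    {w : CInf m × CInf p} :
    w ∈ (interconnect e S).behaviour ↔ w ∈ S.behaviour ∧ w.1 ∈ e.inputBehaviour := by
  change applyDiff (interconnect e S).G w.2 = applyDiff (interconnect e S).H w.1 ↔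
    applyDiff S.G w.2 = applyDiff S.H w.1 ∧ 0 = applyDiff e.E w.1
  rw [funext_iff, funext_iff, funext_iff]
  change (∀ x : Fin (S.rows + e.rows), _) ↔ _
  rw [← finSumFinEquiv.forall_congr_right, Sum.forall]
  refine and_congr (forall_congr' fun i => ?_) (forall_congr' fun i => ?_) <;>
    simp [applyDiff, interconnect]

theorem toRat_mul {r n k : ℕ} (A : Matrix (Fin r) (Fin k) ℝ[X])
    (B : Matrix (Fin k) (Fin n) ℝ[X]) : toRat (A * B) = toRat A * toRat B :=
  Matrix.map_mul

theorem det_toRat {p : ℕ} (A : Matrix (Fin p) (Fin p) ℝ[X]) :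
    (toRat A).det = algebraMap ℝ[X] (RatFunc ℝ) A.det :=
  (RingHom.map_det _ A).symm

theorem isUnit_det_toRat {p : ℕ} {A : Matrix (Fin p) (Fin p) ℝ[X]} :
    IsUnit (toRat A).det ↔ A.det ≠ 0 := by
  rw [det_toRat, isUnit_iff_ne_zero]
  exact map_ne_zero_iff _ (RatFunc.algebraMap_injective ℝ)

theorem IOSystem.det_ne_zero {m p : ℕ} (S : IOSystem m p) : S.P.det ≠ 0 := by
  obtain ⟨N, hN⟩ := S.invertible
  exact isUnit_det_toRat.1 (Matrix.isUnit_det_of_right_inverse hN)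

/-- The system `W P y = W Q u`; it has the same transfer matrix as `P y = Q u`. -/
def IOSystem.leftMul {m p : ℕ} (W : Matrix (Fin p) (Fin p) ℝ[X]) (hW : W.det ≠ 0)
    (S : IOSystem m p) : IOSystem m p where
  P := W * S.P
  Q := W * S.Q
  invertible := ⟨_, Matrix.mul_nonsing_inv _ (isUnit_det_toRat.2 (by
    rw [Matrix.det_mul]; exact mul_ne_zero hW S.det_ne_zero))⟩
  proper := by
    rw [toRat_mul, toRat_mul, Matrix.mul_inv_rev, Matrix.mul_assoc, ← Matrix.mul_assoc (toRat W)⁻¹,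
      Matrix.nonsing_inv_mul _ (isUnit_det_toRat.2 hW), Matrix.one_mul]
    exact S.proper

theorem zero_mem_inputBehaviour {m : ℕ} (e : InputSystem m) : 0 ∈ e.inputBehaviour :=
  (applyDiff_zero e.E).symm

/-! ### Implementations of a contract -/

variable {m p : ℕ} {C : Contract m p} {S : IOSystem m p}

/-- Only the largest compatible environment, namely the assumptions themselves, matters. -/
theorem implements_iff :
    Implements S C ↔ ∀ u ∈ C.A.inputBehaviour, ∀ y, (u, y) ∈ S.toExt.behaviour →
      (u, y) ∈ C.Γ.behaviour :=
  ⟨fun h _ hu _ hy => h C.A subset_rfl (mem_interconnect.2 ⟨hy, hu⟩),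
    fun h _ he _ hw => h _ (he (mem_interconnect.1 hw).2) _ (mem_interconnect.1 hw).1⟩

theorem Implements.applyDiff_eq_zero (h : Implements S C) {z : CInf p}
    (hz : applyDiff S.P z = 0) : applyDiff C.Γ.G z = 0 := by
  have : applyDiff C.Γ.G z = applyDiff C.Γ.H 0 :=
    implements_iff.1 h 0 (zero_mem_inputBehaviour _) z
      (show applyDiff S.P z = applyDiff S.Q 0 by rw [hz, applyDiff_zero])
  rw [this, applyDiff_zero]

/-- The output equation of an implementation is solvable for each input. -/
theorem IOSystem.exists_output (S : IOSystem m p) (u : CInf m) :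
    ∃ y, (u, y) ∈ S.toExt.behaviour :=
  exists_applyDiff_eq S.det_ne_zero (applyDiff S.Q u)

/-- Being an implementation is preserved by premultiplication as long as the homogeneous solutions
stay inside the guarantees. -/
theorem Implements.leftMul (h : Implements S C) {W : Matrix (Fin p) (Fin p) ℝ[X]}
    (hW : W.det ≠ 0)
    (hker : ∀ z : CInf p, applyDiff (W * S.P) z = 0 → applyDiff C.Γ.G z = 0) :
    Implements (S.leftMul W hW) C := by
  rw [implements_iff] at h ⊢
  intro u hu y hy
  obtain ⟨y₀, hy₀⟩ := S.exists_output u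
  have hΓ : applyDiff C.Γ.G y₀ = applyDiff C.Γ.H u := h u hu y₀ hy₀
  have hy' : applyDiff (W * S.P) y = applyDiff (W * S.Q) u := hy
  have hy₀' : applyDiff S.P y₀ = applyDiff S.Q u := hy₀
  have hz := hker (y - y₀) (by
    rw [applyDiff_sub, hy', applyDiff_mul W S.P, hy₀', applyDiff_mul, sub_self])
  rw [applyDiff_sub, sub_eq_zero] at hz
  exact hz.trans hΓ

/-- Since homogeneous solutions of the implementation satisfy the guarantee, the rows of the
guarantee are polynomial combinations of the rows of `P(s)`. -/
theorem Implements.row_mem_span (h : Implements S C) (i : Fin C.Γ.rows) :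
    C.Γ.G.row i ∈ Submodule.span ℝ[X] (Set.range S.P.row) := by
  by_contra hi
  obtain ⟨w, hw, hne, -⟩ := exists_trajectory_of_notMem hi
  exact hne ((applyDiff_apply _ _ i).symm.trans
    (congrFun (h.applyDiff_eq_zero ((applyDiff_eq_zero_iff _ _).2 hw)) i))

/-- Each autonomous trajectory `z` with `G(d/dt) z = 0` is an output, at input zero, of some
implementation. The rows of its output matrix are taken to generate those polynomial combinations
of the rows of `P` that annihilate `z`. -/
theorem Implements.exists_of_autonomous (h : Implements S C) {z : CInf p}
    (hz : applyDiff C.Γ.G z = 0) {q : ℝ[X]} (hq : q ≠ 0) (hqz : ∀ x, q • rowAct z x = 0) :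
    ∃ S' : IOSystem m p, Implements S' C ∧ applyDiff S'.P z = 0 := by
  obtain ⟨W, hW, hWN, hgen⟩ := exists_matrix_of_smul_mem
    (N := LinearMap.ker ((rowAct z).comp (Matrix.vecMulLinear S.P))) hq
    (fun x => by
      rw [LinearMap.mem_ker, map_smul, LinearMap.comp_apply, hqz])
  refine ⟨S.leftMul W hW, h.leftMul hW fun y hy => ?_, ?_⟩
  · funext i
    obtain ⟨c, hc⟩ := (Submodule.mem_span_range_iff_exists_fun _).1 (h.row_mem_span i)
    have hc' : Matrix.vecMul c S.P = C.Γ.G i := by rw [Matrix.vecMul_eq_sum]; exact hc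
    obtain ⟨d, rfl⟩ := hgen c (by
      rw [LinearMap.mem_ker, LinearMap.comp_apply, Matrix.vecMulLinear_apply, hc',
        ← applyDiff_apply, hz]
      rfl)
    rw [applyDiff_apply, ← hc', Matrix.vecMul_vecMul, rowAct_vecMul, hy]
    simp
  · funext i
    change applyDiff (W * S.P) z i = 0
    rw [applyDiff_apply, Matrix.mul_apply_eq_vecMul]
    exact hWN i

/-- If every implementation of `C` has its homogeneous solutions in the kernel of `G'(d/dt)`, then
so has the guarantee of a consistent contract `C`, because autonomous trajectories suffice to
decide membership of a row in the row module of the guarantee. -/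
theorem Implements.applyDiff_eq_zero_of_forall (h : Implements S C) {r : ℕ}
    {G' : Matrix (Fin r) (Fin p) ℝ[X]}
    (hall : ∀ S' : IOSystem m p, Implements S' C → ∀ z, applyDiff S'.P z = 0 →
      applyDiff G' z = 0) {z : CInf p} (hz : applyDiff C.Γ.G z = 0) : applyDiff G' z = 0 := by
  funext i
  rw [applyDiff_apply]
  refine (applyDiff_eq_zero_iff _ _).1 hz (G'.row i) ?_
  by_contra hi
  obtain ⟨w, hw, hne, q, hq, hqw⟩ := exists_trajectory_of_notMem hi
  obtain ⟨S', hS', hS'w⟩ :=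
    h.exists_of_autonomous ((applyDiff_eq_zero_iff _ _).2 hw) hq hqw
  exact hne ((applyDiff_apply _ _ i).symm.trans (congrFun (hall S' hS' w hS'w) i))

end LinearContract

end

theorem mainTheorem3 {m p : ℕ} (C₁ C₂ : LinearContract.Contract m p)
    (hC₁ : LinearContract.Consistent C₁) :
    (LinearContract.Refines C₁ C₂ ↔
      C₂.A.inputBehaviour ⊆ C₁.A.inputBehaviour ∧
        (LinearContract.interconnect C₂.A C₁.Γ).behaviour ⊆ C₂.Γ.behaviour) ∧
    (LinearContract.Refines C₁ C₂ → LinearContract.Consistent C₂) := by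
  open LinearContract in
  obtain ⟨S, hS⟩ := hC₁
  refine ⟨⟨fun ⟨hE, hI⟩ => ?_, fun ⟨hA, hΓ⟩ => ⟨fun e he => he.trans hA, fun S' hS' => ?_⟩⟩,
    fun h => ⟨S, h.2 S hS⟩⟩
  · have hA : C₂.A.inputBehaviour ⊆ C₁.A.inputBehaviour := hE C₂.A subset_rfl
    refine ⟨hA, ?_⟩
    rintro ⟨u, y⟩ hw
    obtain ⟨hy, hu⟩ := mem_interconnect.1 hw
    -- Compare `y` with an output `y₀` of the implementation `S`; both guarantees hold for `y₀`.
    obtain ⟨y₀, hy₀⟩ := S.exists_output u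
    have h₁ : applyDiff C₁.Γ.G y₀ = applyDiff C₁.Γ.H u := implements_iff.1 hS u (hA hu) y₀ hy₀
    have h₂ : applyDiff C₂.Γ.G y₀ = applyDiff C₂.Γ.H u :=
      implements_iff.1 (hI S hS) u hu y₀ hy₀
    have hy' : applyDiff C₁.Γ.G y = applyDiff C₁.Γ.H u := hy
    have hz : applyDiff C₂.Γ.G (y - y₀) = 0 :=
      hS.applyDiff_eq_zero_of_forall (fun S' hS' _ => (hI S' hS').applyDiff_eq_zero)
        (by rw [applyDiff_sub, hy', h₁, sub_self])
    rw [applyDiff_sub, sub_eq_zero] at hz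
    exact hz.trans h₂
  · rw [implements_iff] at hS' ⊢
    exact fun u hu y hy => hΓ (mem_interconnect.2 ⟨hS' u (hA hu) y hy, hu⟩)
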